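/- All groups are finite. For a group $G$ write $G' = [G,G]$ and $G_3 = [G',G]$. Call $G$ a Camina group if for every $g \in G \setminus G'$ the conjugacy class of $g$ equals the coset $gG'$. Let $p$ be a prime and let $G$ be a finite $p$-group that is a Camina group and has nilpotence class exactly $3$. If $|G_3| > |G':G_3|^{1/2}$, then $C_G(G') = G'$. -/

import Mathlib

open scoped Pointwise

/-- A group `G` is a Camina group if the conjugacy class of every `g` outside the derived subgroup
`G'` is the full coset `g G'`. -/
def IsCaminaGroup (G : Type*) [Group G] : Prop :=
  ∀ g : G, g ∉ commutator G → conjugatesOf g = g • (commutator G : Set G)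

/-- The third term `G₃ = [G', G]` of the lower central series `G₁ = G`, `G₂ = G'`. -/
def thirdTerm (G : Type*) [Group G] : Subgroup G := ⁅commutator G, (⊤ : Subgroup G)⁆

/-! Suppose that some `a ∉ G'` lies in `C = C_G(G')`. Then
`|G₃|² ≤ |C : G'| ≤ |G : C| ≤ |G' : G₃|`.

* Right: if `⁅a, w⁆ ∈ G₃`, then `w` commutes with every `⁅a, y⁆`, hence with `G' = ⁅a, G⁆`. So the
  homomorphism `w ↦ ⁅a, w⁆ G₃` from `G` to `G' / G₃` has its kernel in `C`.
* Middle: let `χ ≠ 1` be a character of `G'` which is trivial on `Z(G) ∩ G'`. The radical of the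
  pairing `χ ⁅x, y⁆` on `G` is contained in `G'`, and `C` is isotropic since `⁅C, C⁆ ≤ Z(G)`.
* Left: `C` has class two and centre `G'`, and `G₃ ≤ ⁅h, C⁆` for every `h ∈ C \ G'`. So composing
  the commutator form of `V = C / G'` with the nonzero functionals on `U = G₃` gives nondegenerate
  alternating forms over `𝔽_p`. Their determinant is the square of a polynomial of degree
  `dim V / 2` in `dim U` variables, which by Chevalley–Warning has a nontrivial zero unless
  `2 dim U ≤ dim V`.
-/

open scoped commutatorElement IsMulCommutative

section Alternating

/-- A matrix is alternating if it is skew-symmetric with zero diagonal; skew-symmetry implies the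
vanishing of the diagonal only away from characteristic two. -/
structure IsAlternating {ι R : Type*} [Ring R] (M : Matrix ι ι R) : Prop where
  diag_eq_zero : ∀ i, M i i = 0
  apply_swap : ∀ i j, M j i = -M i j

namespace IsAlternating

variable {ι R K : Type*} [Fintype ι] [DecidableEq ι] [CommRing R] [Field K]

theorem map {R S : Type*} {ι : Type*} [Ring R] [Ring S] {M : Matrix ι ι R} (hM : IsAlternating M)
    (f : R →+* S) : IsAlternating (M.map f) where
  diag_eq_zero i := by rw [Matrix.map_apply, hM.diag_eq_zero, map_zero]
  apply_swap i j := by rw [Matrix.map_apply, Matrix.map_apply, hM.apply_swap, map_neg]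

theorem submatrix {R : Type*} {ι κ : Type*} [Ring R] {M : Matrix ι ι R} (hM : IsAlternating M)
    (f : κ → ι) : IsAlternating (M.submatrix f f) where
  diag_eq_zero k := hM.diag_eq_zero (f k)
  apply_swap k l := hM.apply_swap (f k) (f l)

theorem exists_det_eq_sq_mul_det {M : Matrix (Fin 2 ⊕ ι) (Fin 2 ⊕ ι) K} (hM : IsAlternating M)
    (hpivot : M (Sum.inl 0) (Sum.inl 1) ≠ 0) :
    ∃ N : Matrix ι ι K, IsAlternating N ∧ M.det = M (Sum.inl 0) (Sum.inl 1) ^ 2 * N.det := by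
  set c := M (Sum.inl 0) (Sum.inl 1)
  have hA : M.toBlocks₁₁ = !![0, c; -c, 0] := by
    ext a b
    fin_cases a <;> fin_cases b <;>
      simp [Matrix.toBlocks₁₁, hM.diag_eq_zero, hM.apply_swap (Sum.inl 0) (Sum.inl 1), c]
  let A' : Matrix (Fin 2) (Fin 2) K := !![0, -c⁻¹; c⁻¹, 0]
  have hA' : M.toBlocks₁₁ * A' = 1 := by
    rw [hA]
    ext a b
    fin_cases a <;> fin_cases b <;> simp [A', hpivot]
  let : Invertible M.toBlocks₁₁ := ⟨A', mul_eq_one_comm.mp hA', hA'⟩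
  have hinv : ⅟M.toBlocks₁₁ = A' := rfl
  set N := M.toBlocks₂₂ - M.toBlocks₂₁ * A' * M.toBlocks₁₂ with hN
  have hN_apply (k l : ι) : N k l = M (Sum.inr k) (Sum.inr l) -
      (M (Sum.inr k) (Sum.inl 1) * M (Sum.inl 0) (Sum.inr l) -
        M (Sum.inr k) (Sum.inl 0) * M (Sum.inl 1) (Sum.inr l)) * c⁻¹ := by
    simp only [N, A', Matrix.toBlocks₂₂, Matrix.toBlocks₂₁, Matrix.toBlocks₁₂, Matrix.sub_apply,
      Matrix.of_apply, Matrix.mul_apply, Matrix.cons_val', Matrix.cons_val_fin_one,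
      Fin.sum_univ_two, Matrix.cons_val_zero, Matrix.cons_val_one]
    ring
  refine ⟨N, ⟨fun k => ?_, fun k l => ?_⟩, ?_⟩
  · rw [hN_apply, hM.diag_eq_zero, hM.apply_swap (Sum.inl 0), hM.apply_swap (Sum.inl 1)]
    ring
  · rw [hN_apply, hN_apply, hM.apply_swap (Sum.inr k) (Sum.inr l), hM.apply_swap (Sum.inl 0),
      hM.apply_swap (Sum.inl 0), hM.apply_swap (Sum.inl 1), hM.apply_swap (Sum.inl 1)]
    ring
  · calc
      M.det = M.toBlocks₁₁.det * N.det := by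
        rw [← M.fromBlocks_toBlocks, Matrix.det_fromBlocks₁₁, hinv, hN, M.fromBlocks_toBlocks]
      _ = c ^ 2 * N.det := by rw [hA, Matrix.det_fin_two_of]; ring

theorem isSquare_det_of_field {M : Matrix ι ι K} (hM : IsAlternating M) : IsSquare M.det := by
  induction hn : Fintype.card ι using Nat.strong_induction_on generalizing ι with
  | _ n ih =>
  subst hn
  by_cases hzero : ∃ i j, M i j ≠ 0
  · obtain ⟨i, j, hij⟩ := hzero
    have hne : i ≠ j := by
      rintro rfl
      exact hij (hM.diag_eq_zero i)
    have hinj : Function.Injective ![i, j] := by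
      intro a b
      fin_cases a <;> fin_cases b <;> simp [hne, hne.symm]
    let e : Fin 2 ⊕ ↥(Set.range ![i, j])ᶜ ≃ ι :=
      ((Equiv.ofInjective _ hinj).sumCongr (Equiv.refl _)).trans (Equiv.Set.sumCompl _)
    obtain ⟨N, hN, hdet⟩ := (hM.submatrix e).exists_det_eq_sq_mul_det hij
    have hcard : Fintype.card ↥(Set.range ![i, j])ᶜ < Fintype.card ι :=
      Fintype.card_subtype_lt (x := i) (by simp)
    rw [← M.det_submatrix_equiv_self e, hdet]
    exact (IsSquare.sq _).mul (ih _ hcard hN rfl)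
  · push Not at hzero
    obtain rfl : M = 0 := Matrix.ext hzero
    cases isEmpty_or_nonempty ι <;> simp

theorem isSquare_det [IsDomain R] [IsIntegrallyClosed R] {M : Matrix ι ι R}
    (hM : IsAlternating M) : IsSquare M.det := by
  obtain ⟨s, hs⟩ := (hM.map (algebraMap R (FractionRing R))).isSquare_det_of_field
  rw [← RingHom.mapMatrix_apply, ← RingHom.map_det] at hs
  obtain ⟨r, rfl⟩ := IsIntegrallyClosed.exists_algebraMap_eq_of_isIntegral_pow (R := R) (x := s)
    two_pos (by rw [sq, ← hs]; exact isIntegral_algebraMap)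
  exact ⟨r, IsFractionRing.injective R (FractionRing R) (by rw [hs, map_mul])⟩

end IsAlternating
end Alternating

section Chevalley

open MvPolynomial Module

theorem totalDegree_det_le {σ R ι : Type*} [CommRing R] [Fintype ι] [DecidableEq ι] {d : ℕ}
    {M : Matrix ι ι (MvPolynomial σ R)} (hM : ∀ i j, (M i j).totalDegree ≤ d) :
    M.det.totalDegree ≤ Fintype.card ι * d := by
  rw [Matrix.det_apply]
  refine (totalDegree_finsetSum _ _).trans (Finset.sup_le fun τ _ => ?_)
  calc
    _ ≤ (∏ i, M (τ i) i).totalDegree := totalDegree_smul_le _ _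
    _ ≤ ∑ i, (M (τ i) i).totalDegree := totalDegree_finsetProd _ _
    _ ≤ ∑ _i : ι, d := Finset.sum_le_sum fun i _ => hM (τ i) i
    _ = Fintype.card ι * d := by rw [Finset.sum_const, Finset.card_univ, smul_eq_mul]

theorem exists_ne_zero_eval_eq_zero {σ K : Type*} [Fintype σ] [Field K] [Finite K]
    {P : MvPolynomial σ K} (hdeg : P.totalDegree < Fintype.card σ) (h0 : eval 0 P = 0) :
    ∃ x ≠ 0, eval x P = 0 := by
  classical
  have := Fintype.ofFinite K
  by_contra! hne
  have hcard : Fintype.card {x // eval x P = 0} = 1 :=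
    Fintype.card_eq_one_iff.2
      ⟨⟨0, h0⟩, fun x => Subtype.ext (not_imp_not.1 (hne x) x.2)⟩
  obtain ⟨p, hp⟩ := CharP.exists K
  have hdvd : p ∣ 1 := hcard ▸ char_dvd_card_solutions p hdeg
  exact CharP.char_ne_one K p (Nat.dvd_one.1 hdvd)

theorem two_mul_card_le_of_det_sum_smul_ne_zero {σ ι K : Type*} [Fintype σ] [Fintype ι]
    [DecidableEq ι] [Nonempty ι] [Field K] [Finite K] (A : σ → Matrix ι ι K)
    (halt : ∀ k, IsAlternating (A k)) (hdet : ∀ x : σ → K, x ≠ 0 → (∑ k, x k • A k).det ≠ 0) :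
    2 * Fintype.card σ ≤ Fintype.card ι := by
  let M : Matrix ι ι (MvPolynomial σ K) := ∑ k, (X k : MvPolynomial σ K) • (A k).map C
  have hM_apply (i j : ι) : M i j = ∑ k, X k * C (A k i j) := by
    simp [M, Matrix.sum_apply]
  have hM : IsAlternating M :=
    ⟨fun i => by simp [hM_apply, (halt _).diag_eq_zero],
      fun i j => by simp [hM_apply, (halt _).apply_swap i j]⟩
  have hdeg : M.det.totalDegree ≤ Fintype.card ι := by
    refine (totalDegree_det_le fun i j => ?_).trans (mul_one _).le
    rw [hM_apply]
    exact totalDegree_finsetSum_le fun k _ => (totalDegree_mul _ _).trans (by simp)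
  have heval (x : σ → K) : eval x M.det = (∑ k, x k • A k).det := by
    rw [RingHom.map_det]
    congr 1
    ext i j
    simp [hM_apply, Matrix.sum_apply]
  obtain ⟨P, hP⟩ := hM.isSquare_det
  have hPeval (x : σ → K) : eval x P = 0 ↔ (∑ k, x k • A k).det = 0 := by
    rw [← heval, hP, map_mul, mul_self_eq_zero]
  have hPdeg : 2 * P.totalDegree ≤ Fintype.card ι := by
    rcases eq_or_ne P 0 with rfl | hP0
    · simp
    · rwa [two_mul, ← totalDegree_mul_of_isDomain hP0 hP0, ← hP]
  by_contra! hlt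
  obtain ⟨x, hx, hPx⟩ := exists_ne_zero_eval_eq_zero (P := P) (by lia) ((hPeval 0).2 (by simp))
  exact hdet x hx ((hPeval x).1 hPx)

variable {K V E U : Type*} [Field K] [Finite K] [AddCommGroup V] [Module K V]
  [FiniteDimensional K V] [Nontrivial V] [AddCommGroup E] [Module K E] [FiniteDimensional K E]
  [AddCommGroup U] [Module K U] [FiniteDimensional K U]

theorem two_mul_finrank_le_of_separatingLeft (L : E →ₗ[K] V →ₗ[K] V →ₗ[K] K)
    (halt : ∀ x, (L x).IsAlt) (hsep : ∀ x ≠ 0, (L x).SeparatingLeft) :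
    2 * finrank K E ≤ finrank K V := by
  classical
  let b := finBasis K V
  let c := finBasis K E
  let A k := LinearMap.toMatrix₂ b b (L (c k))
  have hA (k) : IsAlternating (A k) :=
    ⟨fun i => by simpa [A] using halt (c k) (b i),
      fun i j => by simpa [A] using ((halt (c k)).neg (b i) (b j)).symm⟩
  have hsum (x : Fin (finrank K E) → K) :
      ∑ k, x k • A k = LinearMap.toMatrix₂ b b (L (c.equivFun.symm x)) := by
    simp [A, Basis.equivFun_symm_apply]
  have : Nonempty (Fin (finrank K V)) := ⟨⟨0, finrank_pos⟩⟩
  have h := two_mul_card_le_of_det_sum_smul_ne_zero A hA fun x hx => by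
    rw [hsum, ← LinearMap.separatingLeft_iff_det_ne_zero]
    exact hsep _ (c.equivFun.symm.map_ne_zero_iff.2 hx)
  rwa [Fintype.card_fin, Fintype.card_fin] at h

theorem two_mul_finrank_le_of_surjective (β : V →ₗ[K] V →ₗ[K] U) (halt : β.IsAlt)
    (hsurj : ∀ v ≠ 0, Function.Surjective (β v)) : 2 * finrank K U ≤ finrank K V := by
  let L : Dual K U →ₗ[K] V →ₗ[K] V →ₗ[K] K :=
    LinearMap.lcomp K (V →ₗ[K] K) β ∘ₗ LinearMap.llcomp K V U K
  rw [← Subspace.dual_finrank_eq]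
  refine two_mul_finrank_le_of_separatingLeft L (fun l v => ?_) fun l hl v hv => ?_
  · simp [L, halt v]
  · by_contra hv0
    refine hl (LinearMap.ext fun u => ?_)
    obtain ⟨w, rfl⟩ := hsurj v hv0 u
    exact hv w

end Chevalley

section Pairing

theorem card_sq_le_card_of_le_range {p : ℕ} [Fact p.Prime] {V T : Type*} [AddCommGroup V]
    [Finite V] [Nontrivial V] [AddCommGroup T] [Finite T] [Module (ZMod p) V] [Module (ZMod p) T]
    (κ : V →+ V →+ T) (halt : ∀ x, κ x x = 0) {U : AddSubgroup T}
    (hU : ∀ x ≠ 0, U ≤ (κ x).range) : Nat.card U ^ 2 ≤ Nat.card V := by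
  let β : V →ₗ[ZMod p] V →ₗ[ZMod p] T :=
    LinearMap.mk₂ (ZMod p) (fun x y => κ x y)
      (fun x x' y => by simp) (fun c x y => ZMod.map_smul (κ.flip y) c x)
      (fun x y y' => by simp) (fun c x y => ZMod.map_smul (κ x) c y)
  let U' : Submodule (ZMod p) T := AddSubgroup.toZModSubmodule p U
  obtain ⟨r, hr⟩ := U'.subtype.exists_leftInverse_of_injective U'.ker_subtype
  have hrank : 2 * Module.finrank (ZMod p) U' ≤ Module.finrank (ZMod p) V := by
    refine two_mul_finrank_le_of_surjective (β.compr₂ r) (fun x => ?_) fun x hx u => ?_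
    · exact (congrArg r (halt x)).trans r.map_zero
    · obtain ⟨y, hy⟩ := hU x hx u.2
      exact ⟨y, (congrArg r hy).trans (LinearMap.congr_fun hr u)⟩
  calc
    Nat.card U ^ 2 = Nat.card U' ^ 2 := rfl
    _ = p ^ (2 * Module.finrank (ZMod p) U') := by
      rw [Module.natCard_eq_pow_finrank (K := ZMod p), Nat.card_zmod, mul_comm, pow_mul]
    _ ≤ p ^ Module.finrank (ZMod p) V := Nat.pow_le_pow_right (Fact.out : p.Prime).pos hrank
    _ = Nat.card V := by rw [Module.natCard_eq_pow_finrank (K := ZMod p), Nat.card_zmod]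

theorem card_sq_le_card_of_pow_eq_one {p : ℕ} [Fact p.Prime] {Q T : Type*} [CommGroup Q]
    [Finite Q] [Nontrivial Q] [CommGroup T] [Finite T] (hQ : ∀ x : Q, x ^ p = 1)
    (hT : ∀ t : T, t ^ p = 1) (κ : Q →* Q →* T) (halt : ∀ x, κ x x = 1) {U : Subgroup T}
    (hU : ∀ x ≠ 1, U ≤ (κ x).range) : Nat.card U ^ 2 ≤ Nat.card Q := by
  let : Module (ZMod p) (Additive Q) := AddCommGroup.zmodModule hQ
  let : Module (ZMod p) (Additive T) := AddCommGroup.zmodModule hT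
  let κ' : Additive Q →+ Additive Q →+ Additive T :=
    AddMonoidHom.mk' (fun x => (κ x.toMul).toAdditive) fun x x' =>
      congrArg MonoidHom.toAdditive (map_mul κ x.toMul x'.toMul)
  exact card_sq_le_card_of_le_range (p := p) κ' halt (U := U.toAddSubgroup) hU

end Pairing

section Characters

variable {G L : Type*} [Group G] [Field L]

theorem card_le_index_of_forall_le_ker (C : Subgroup G) [C.FiniteIndex] (S : Set (G →* Lˣ))
    (hS : ∀ χ ∈ S, C ≤ χ.ker) : Nat.card S ≤ C.index := by
  let v (χ : S) (q : G ⧸ C) : L := χ.1 q.out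
  have hv_mk : LinearMap.funLeft L L (QuotientGroup.mk : G → G ⧸ C) ∘ v =
      fun χ : S => ⇑((Units.coeHom L).comp χ.1) := by
    ext χ g
    have hker := hS χ χ.2 (QuotientGroup.eq.1 (QuotientGroup.out_eq' (g : G ⧸ C)))
    rw [MonoidHom.mem_ker, map_mul, map_inv, inv_mul_eq_one] at hker
    exact congrArg Units.val hker
  have hinj : Function.Injective fun χ : S => (Units.coeHom L).comp χ.1 := fun χ ψ h =>
    Subtype.ext ((MonoidHom.cancel_left Units.coeHom_injective).1 h)
  have hv : LinearIndependent L v := by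
    refine LinearIndependent.of_comp (LinearMap.funLeft L L QuotientGroup.mk) ?_
    rw [hv_mk]
    exact (linearIndependent_monoidHom G L).comp _ hinj
  have := hv.finite
  have := Fintype.ofFinite S
  have := Fintype.ofFinite (G ⧸ C)
  calc
    Nat.card S = Fintype.card S := Nat.card_eq_fintype_card
    _ ≤ Module.finrank L (G ⧸ C → L) := hv.fintype_card_le_finrank
    _ = C.index := by rw [Module.finrank_fintype_fun_eq_card, ← Nat.card_eq_fintype_card]; rfl

theorem relIndex_ker_le_index_of_isotropic (κ : G →* G →* Lˣ) (C : Subgroup G) [C.FiniteIndex]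
    (hC : ∀ a ∈ C, ∀ b ∈ C, κ a b = 1) : κ.ker.relIndex C ≤ C.index := by
  rw [Subgroup.relIndex_ker]
  refine card_le_index_of_forall_le_ker C (C.map κ : Set (G →* Lˣ)) ?_
  rintro _ ⟨a, ha, rfl⟩ b hb
  exact hC a ha b hb

theorem exists_ne_one_le_ker {A : Type*} [CommGroup A] [Finite A] {N : Subgroup A} (hN : N ≠ ⊤) :
    ∃ χ : A →* ℂˣ, χ ≠ 1 ∧ N ≤ χ.ker := by
  obtain ⟨a, ha⟩ : ∃ a, a ∉ N := by simpa [Subgroup.eq_top_iff'] using hN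
  have ha' : (a : A ⧸ N) ≠ 1 := by rwa [Ne, QuotientGroup.eq_one_iff]
  obtain ⟨χ, hχ⟩ := CommGroup.exists_apply_ne_one_of_hasEnoughRootsOfUnity (A ⧸ N) ℂ ha'
  refine ⟨χ.comp (QuotientGroup.mk' N), fun h => hχ (DFunLike.congr_fun h a), fun x hx => ?_⟩
  rw [MonoidHom.mem_ker, MonoidHom.comp_apply, QuotientGroup.mk'_apply,
    (QuotientGroup.eq_one_iff x).2 hx, map_one]

end Characters

section CommutatorPairing

variable {G A : Type*} [Group G] [CommGroup A]

theorem commutatorElement_mem_commutator (g h : G) : ⁅g, h⁆ ∈ commutator G :=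
  Subgroup.commutator_mem_commutator (Subgroup.mem_top g) (Subgroup.mem_top h)

theorem map_conj_eq_of_thirdTerm_le_ker {χ : commutator G →* A}
    (hχ : (thirdTerm G).subgroupOf (commutator G) ≤ χ.ker) (g : G) (x : commutator G) :
    χ (MulAut.conjNormal g x) = χ x := by
  have hmem : MulAut.conjNormal g x * x⁻¹ ∈ χ.ker := hχ <| by
    rw [Subgroup.mem_subgroupOf, thirdTerm, Subgroup.commutator_comm]
    simpa [commutatorElement_def] using Subgroup.commutator_mem_commutator (Subgroup.mem_top g) x.2
  rwa [MonoidHom.mem_ker, map_mul, map_inv, mul_inv_eq_one] at hmem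

/-- The bimultiplicative pairing `(g, y) ↦ χ ⁅g, y⁆` induced by a homomorphism `χ` from `G'` to a
commutative group which vanishes on `G₃`. -/
def commutatorPairing (χ : commutator G →* A)
    (hχ : (thirdTerm G).subgroupOf (commutator G) ≤ χ.ker) : G →* G →* A :=
  let form (g y : G) : A := χ ⟨⁅g, y⁆, commutatorElement_mem_commutator g y⟩
  have form_mul_right (g y z : G) : form g (y * z) = form g y * form g z := by
    dsimp only [form]
    rw [← map_conj_eq_of_thirdTerm_le_ker hχ y ⟨⁅g, z⁆, _⟩, ← map_mul]
    congr 1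
    ext
    simp [commutatorElement_mul_right_eq_mul_conj, mul_assoc]
  have form_mul_left (g h y : G) : form (g * h) y = form g y * form h y := by
    dsimp only [form]
    rw [mul_comm, ← map_conj_eq_of_thirdTerm_le_ker hχ g ⟨⁅h, y⁆, _⟩, ← map_mul]
    congr 1
    ext
    simp [commutatorElement_mul_left_eq_conj_mul]
  MonoidHom.mk' (fun g => MonoidHom.mk' (form g) (form_mul_right g)) fun g h =>
    MonoidHom.ext (form_mul_left g h)

end CommutatorPairing

section ClassTwo

variable {H : Type*} [Group H]

theorem mem_center_iff_forall_commutatorElement_eq_one {h : H} :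
    h ∈ Subgroup.center H ↔ ∀ g : H, ⁅h, g⁆ = 1 := by
  simp only [Subgroup.mem_center_iff, commutatorElement_eq_one_iff_mul_comm,
    eq_comm (a := h * _)]

theorem isMulCommutative_commutator_of_le_center (hc : commutator H ≤ Subgroup.center H) :
    IsMulCommutative (commutator H) :=
  Subgroup.le_centralizer_iff_isMulCommutative.1 (hc.trans (Subgroup.center_le_centralizer _))

theorem thirdTerm_eq_bot_iff : thirdTerm H = ⊥ ↔ commutator H ≤ Subgroup.center H :=
  Subgroup.commutator_top_right_eq_bot_iff_le_center

theorem pow_eq_one_of_mem_commutator {p : ℕ} (hc : commutator H ≤ Subgroup.center H)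
    (hpow : ∀ h : H, h ^ p ∈ Subgroup.center H) {x : H} (hx : x ∈ commutator H) : x ^ p = 1 := by
  have := isMulCommutative_commutator_of_le_center hc
  let κ : H →* H →* commutator H :=
    commutatorPairing (MonoidHom.id _) (by simp [thirdTerm_eq_bot_iff.2 hc])
  have hle : commutator H ≤ (powMonoidHom p : commutator H →* commutator H).ker.map
      (commutator H).subtype := by
    refine Subgroup.commutator_le.2 fun h _ g _ => ⟨κ h g, ?_, rfl⟩
    calc
      κ h g ^ p = κ (h ^ p) g := by rw [map_pow, MonoidHom.pow_apply]
      _ = 1 := Subtype.ext (mem_center_iff_forall_commutatorElement_eq_one.1 (hpow h) g)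
  obtain ⟨y, hy, rfl⟩ := hle hx
  exact congrArg Subtype.val hy

theorem card_sq_le_index_center [Finite H] {p : ℕ} [Fact p.Prime]
    (hc : commutator H ≤ Subgroup.center H) (hpow : ∀ h : H, h ^ p ∈ Subgroup.center H)
    (hne : Subgroup.center H ≠ ⊤) {U : Subgroup H}
    (hU : ∀ h ∉ Subgroup.center H, ∀ u ∈ U, ∃ g, ⁅h, g⁆ = u) :
    Nat.card U ^ 2 ≤ (Subgroup.center H).index := by
  have := isMulCommutative_commutator_of_le_center hc
  have : IsMulCommutative (H ⧸ Subgroup.center H) :=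
    Subgroup.Normal.quotient_commutative_iff_commutator_le.2 hc
  have : Nontrivial (H ⧸ Subgroup.center H) := QuotientGroup.nontrivial_iff.2 hne
  let κ : H →* H →* commutator H :=
    commutatorPairing (MonoidHom.id _) (by simp [thirdTerm_eq_bot_iff.2 hc])
  have hleft : Subgroup.center H ≤ κ.ker := fun z hz => MonoidHom.ext fun g =>
    Subtype.ext (mem_center_iff_forall_commutatorElement_eq_one.1 hz g)
  have hright : Subgroup.center H ≤ κ.flip.ker := fun z hz => MonoidHom.ext fun g =>
    Subtype.ext (commutatorElement_eq_one_iff_mul_comm.2 (Subgroup.mem_center_iff.1 hz g))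
  let κ' : H ⧸ Subgroup.center H →* H ⧸ Subgroup.center H →* commutator H :=
    QuotientGroup.lift _ (QuotientGroup.lift _ κ.flip hright).flip fun z hz => by
      ext g
      exact congrArg Subtype.val (DFunLike.congr_fun (hleft hz) g)
  have hUc : U ≤ commutator H := fun u hu => by
    obtain ⟨h, hh⟩ : ∃ h, h ∉ Subgroup.center H := by simpa [Subgroup.eq_top_iff'] using hne
    obtain ⟨g, rfl⟩ := hU h hh u hu
    exact commutatorElement_mem_commutator h g
  rw [← Nat.card_congr (Subgroup.subgroupOfEquivOfLe hUc).toEquiv]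
  refine card_sq_le_card_of_pow_eq_one (p := p) ?_ ?_ κ' ?_ ?_
  · rintro ⟨h⟩
    exact (QuotientGroup.eq_one_iff _).2 (hpow h)
  · exact fun t => Subtype.ext (pow_eq_one_of_mem_commutator hc hpow t.2)
  · rintro ⟨h⟩
    exact Subtype.ext (commutatorElement_self h)
  · rintro ⟨h⟩ hh u hu
    obtain ⟨g, hg⟩ := hU h (mt (QuotientGroup.eq_one_iff h).2 hh) u hu
    exact ⟨g, Subtype.ext hg⟩

end ClassTwo

section Centralizer

variable {G : Type*} [Group G]

theorem mem_centralizer_commutator_iff {a : G} :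
    a ∈ Subgroup.centralizer (commutator G : Set G) ↔ ∀ d ∈ commutator G, ⁅a, d⁆ = 1 := by
  simp only [Subgroup.mem_centralizer_iff, SetLike.mem_coe, commutatorElement_eq_one_iff_mul_comm,
    eq_comm (a := a * _)]

theorem commutator_le_centralizer_commutator (hU : thirdTerm G ≤ Subgroup.center G) :
    commutator G ≤ Subgroup.centralizer (commutator G : Set G) := by
  have hbot : ⁅thirdTerm G, (⊤ : Subgroup G)⁆ = ⊥ :=
    Subgroup.commutator_top_right_eq_bot_iff_le_center.2 hU
  rw [← Subgroup.commutator_eq_bot_iff_le_centralizer]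
  nth_rw 1 [commutator_def]
  refine Subgroup.commutator_commutator_eq_bot_of_rotate ?_ hbot
  rwa [Subgroup.commutator_comm ⊤ (commutator G)]

theorem commute_commutatorElement {a w : G}
    (ha : a ∈ Subgroup.centralizer (commutator G : Set G)) (hw : ⁅a, w⁆ ∈ Subgroup.center G)
    (y : G) : Commute w ⁅a, y⁆ := by
  have hz := mem_center_iff_forall_commutatorElement_eq_one.1 (inv_mem hw)
  refine mul_inv_eq_iff_eq_mul.1 ?_
  -- Conjugation by `w` acts on each entry of the commutator: `w a w⁻¹ = ⁅a, w⁆⁻¹ a`.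
  calc
    w * ⁅a, y⁆ * w⁻¹ = ⁅⁅a, w⁆⁻¹ * a, y * ⁅y⁻¹, w⁆⁆ := by
      simp only [commutatorElement_def]; group
    _ = ⁅a, y * ⁅y⁻¹, w⁆⁆ := by
      rw [commutatorElement_mul_left_eq_conj_mul, hz, mul_one,
        ← Subgroup.mem_center_iff.1 (inv_mem hw), mul_inv_cancel_right]
    _ = ⁅a, y⁆ := by
      rw [commutatorElement_mul_right_eq_mul_conj,
        mem_centralizer_commutator_iff.1 ha _ (commutatorElement_mem_commutator _ _), mul_one,
        mul_inv_cancel_right]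

end Centralizer

theorem subsingleton_of_surjective_pow {p : ℕ} [Fact p.Prime] {P : Type*} [Group P] [Finite P]
    (hP : IsPGroup p P) (hsurj : Function.Surjective fun x : P => x ^ p) : Subsingleton P := by
  obtain ⟨n, hn⟩ := hP.exists_card_eq
  refine subsingleton_of_forall_eq 1 fun x => ?_
  obtain ⟨y, rfl⟩ := hsurj.iterate n x
  rw [pow_iterate, ← hn]
  exact pow_card_eq_one'

namespace IsCaminaGroup

variable {G : Type*} [Group G] (hcam : IsCaminaGroup G)

include hcam

theorem exists_commutatorElement_eq {g u : G} (hg : g ∉ commutator G) (hu : u ∈ commutator G) :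
    ∃ c, ⁅g, c⁆ = u := by
  have hmem : g⁻¹ * u ∈ conjugatesOf g⁻¹ := by
    rw [hcam g⁻¹ (by rwa [inv_mem_iff])]
    exact Set.smul_mem_smul_set hu
  obtain ⟨c, hc⟩ := isConj_iff.1 hmem
  exact ⟨c, by rw [commutatorElement_def, mul_assoc, mul_assoc, ← mul_assoc c, hc,
    mul_inv_cancel_left]⟩

theorem ker_commutatorPairing_le {A : Type*} [CommGroup A] {χ : commutator G →* A}
    (hχ : (thirdTerm G).subgroupOf (commutator G) ≤ χ.ker) (hχ1 : χ ≠ 1) :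
    (commutatorPairing χ hχ).ker ≤ commutator G := by
  intro g hg
  by_contra hgD
  refine hχ1 (MonoidHom.ext fun u => ?_)
  obtain ⟨c, hc⟩ := hcam.exists_commutatorElement_eq hgD u.2
  obtain rfl : ⟨⁅g, c⁆, commutatorElement_mem_commutator g c⟩ = u := Subtype.ext hc
  exact DFunLike.congr_fun hg c

theorem pow_mem_commutator [Finite G] [IsMulCommutative (commutator G)] {p : ℕ} [Fact p.Prime]
    (hpG : IsPGroup p G) (hlt : ¬ commutator G ≤ thirdTerm G) (g : G) : g ^ p ∈ commutator G := by
  let U := (thirdTerm G).subgroupOf (commutator G)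
  let κ := commutatorPairing (QuotientGroup.mk' U) (QuotientGroup.ker_mk' U).ge
  by_contra hg
  have hsurj : Function.Surjective fun x : commutator G ⧸ U => x ^ p := by
    rintro ⟨u⟩
    obtain ⟨y, hy⟩ := hcam.exists_commutatorElement_eq hg u.2
    refine ⟨κ g y, ?_⟩
    calc
      κ g y ^ p = κ (g ^ p) y := by rw [map_pow, MonoidHom.pow_apply]
      _ = QuotientGroup.mk' U u := congrArg (QuotientGroup.mk' U) (Subtype.ext hy)
  have := subsingleton_of_surjective_pow ((hpG.to_subgroup _).to_quotient U) hsurj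
  exact hlt (Subgroup.subgroupOf_eq_top.1 (QuotientGroup.subsingleton_iff.1 this))

theorem mem_centralizer_commutator {a w : G}
    (ha : a ∈ Subgroup.centralizer (commutator G : Set G)) (haD : a ∉ commutator G)
    (hw : ⁅a, w⁆ ∈ Subgroup.center G) : w ∈ Subgroup.centralizer (commutator G : Set G) := by
  refine Subgroup.mem_centralizer_iff.2 fun d hd => ?_
  obtain ⟨y, rfl⟩ := hcam.exists_commutatorElement_eq haD hd
  exact (commute_commutatorElement ha hw y).symm

theorem relIndex_centralizer_le_index [Finite G] (hU : thirdTerm G ≤ Subgroup.center G)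
    (hne : thirdTerm G ≠ ⊥) :
    (commutator G).relIndex (Subgroup.centralizer (commutator G : Set G)) ≤
      (Subgroup.centralizer (commutator G : Set G)).index := by
  have : IsMulCommutative (commutator G) := Subgroup.le_centralizer_iff_isMulCommutative.1
    (commutator_le_centralizer_commutator hU)
  have hproper : (Subgroup.center G).subgroupOf (commutator G) ≠ ⊤ := by
    rwa [Ne, Subgroup.subgroupOf_eq_top, ← thirdTerm_eq_bot_iff]
  obtain ⟨χ, hχ1, hχ⟩ := exists_ne_one_le_ker hproper
  let κ := commutatorPairing χ ((Subgroup.comap_mono hU).trans hχ)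
  have hisotropic : ∀ a ∈ Subgroup.centralizer (commutator G : Set G),
      ∀ b ∈ Subgroup.centralizer (commutator G : Set G), κ a b = 1 := fun a ha b hb =>
    hχ (commutator_centralizer_commutator_le_center G (Subgroup.commutator_mem_commutator ha hb))
  calc
    _ ≤ κ.ker.relIndex (Subgroup.centralizer (commutator G : Set G)) :=
      Subgroup.relIndex_le_of_le_left (hcam.ker_commutatorPairing_le _ hχ1)
        Subgroup.index_ne_zero_of_finite
    _ ≤ _ := relIndex_ker_le_index_of_isotropic κ _ hisotropic

theorem index_centralizer_le [Finite G] (hU : thirdTerm G ≤ Subgroup.center G) {a : G}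
    (ha : a ∈ Subgroup.centralizer (commutator G : Set G)) (haD : a ∉ commutator G) :
    (Subgroup.centralizer (commutator G : Set G)).index ≤
      (thirdTerm G).relIndex (commutator G) := by
  have : IsMulCommutative (commutator G) := Subgroup.le_centralizer_iff_isMulCommutative.1
    (commutator_le_centralizer_commutator hU)
  let U := (thirdTerm G).subgroupOf (commutator G)
  let κ := commutatorPairing (QuotientGroup.mk' U) (QuotientGroup.ker_mk' U).ge
  have hker : (κ a).ker ≤ Subgroup.centralizer (commutator G : Set G) := fun w hw =>
    hcam.mem_centralizer_commutator ha haD <| hU <|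
      (QuotientGroup.eq_one_iff (N := U) ⟨⁅a, w⁆, commutatorElement_mem_commutator a w⟩).1 hw
  calc
    _ ≤ (κ a).ker.index := Subgroup.index_antitone hker
    _ = Nat.card (κ a).range := Subgroup.index_ker _
    _ ≤ Nat.card (commutator G ⧸ U) := Subgroup.card_le_card_group _

theorem exists_mem_centralizer_commutatorElement_eq (hU : thirdTerm G ≤ Subgroup.center G)
    {a u : G} (ha : a ∈ Subgroup.centralizer (commutator G : Set G)) (haD : a ∉ commutator G)
    (hu : u ∈ thirdTerm G) : ∃ w ∈ Subgroup.centralizer (commutator G : Set G), ⁅a, w⁆ = u := by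
  obtain ⟨w, rfl⟩ := hcam.exists_commutatorElement_eq haD (Subgroup.commutator_le_left _ _ hu)
  exact ⟨w, hcam.mem_centralizer_commutator ha haD (hU hu), rfl⟩

theorem center_centralizer_commutator (hU : thirdTerm G ≤ Subgroup.center G)
    (hne : thirdTerm G ≠ ⊥) :
    Subgroup.center (Subgroup.centralizer (commutator G : Set G)) =
      (commutator G).subgroupOf (Subgroup.centralizer (commutator G : Set G)) := by
  ext h
  rw [mem_center_iff_forall_commutatorElement_eq_one, Subgroup.mem_subgroupOf]
  refine ⟨fun hh => ?_, fun hh g => Subtype.ext ?_⟩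
  · by_contra hhD
    obtain ⟨u, hu, hu1⟩ := (Subgroup.bot_or_exists_ne_one _).resolve_left hne
    obtain ⟨w, hw, rfl⟩ := hcam.exists_mem_centralizer_commutatorElement_eq hU h.2 hhD hu
    exact hu1 (congrArg Subtype.val (hh ⟨w, hw⟩))
  · exact commutatorElement_eq_one_iff_mul_comm.2 (Subgroup.mem_centralizer_iff.1 g.2 h hh)

theorem card_thirdTerm_sq_le [Finite G] {p : ℕ} [Fact p.Prime] (hpG : IsPGroup p G)
    (hU : thirdTerm G ≤ Subgroup.center G) (hne : thirdTerm G ≠ ⊥) {a : G}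
    (ha : a ∈ Subgroup.centralizer (commutator G : Set G)) (haD : a ∉ commutator G) :
    Nat.card (thirdTerm G) ^ 2 ≤
      (commutator G).relIndex (Subgroup.centralizer (commutator G : Set G)) := by
  have hDC := commutator_le_centralizer_commutator hU
  have : IsMulCommutative (commutator G) := Subgroup.le_centralizer_iff_isMulCommutative.1 hDC
  have hUC : thirdTerm G ≤ Subgroup.centralizer (commutator G : Set G) :=
    (Subgroup.commutator_le_left _ _).trans hDC
  have hlt : ¬ commutator G ≤ thirdTerm G := fun h => hne (thirdTerm_eq_bot_iff.2 (h.trans hU))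
  set C := Subgroup.centralizer (commutator G : Set G)
  have hcenter : Subgroup.center C = (commutator G).subgroupOf C :=
    hcam.center_centralizer_commutator hU hne
  have hmem (h : C) : h ∈ Subgroup.center C ↔ (h : G) ∈ commutator G := by
    rw [hcenter, Subgroup.mem_subgroupOf]
  have hclass : commutator C ≤ Subgroup.center C := Subgroup.commutator_le.2 fun x _ y _ =>
    (hmem _).2 (commutatorElement_mem_commutator (x : G) y)
  rw [← Nat.card_congr (Subgroup.subgroupOfEquivOfLe hUC).toEquiv, Subgroup.relIndex, ← hcenter]
  refine card_sq_le_index_center (p := p) hclass (fun h => ?_) (fun htop => ?_) ?_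
  · exact (hmem _).2 (hcam.pow_mem_commutator hpG hlt h)
  · exact haD ((hmem ⟨a, ha⟩).1 (htop ▸ Subgroup.mem_top _))
  · intro h hh u hu
    obtain ⟨w, hw, hwu⟩ :=
      hcam.exists_mem_centralizer_commutatorElement_eq hU h.2 (mt (hmem h).2 hh) hu
    exact ⟨⟨w, hw⟩, Subtype.ext hwu⟩

end IsCaminaGroup

section ClassThree

variable {G : Type*} [Group G] [Group.IsNilpotent G]

theorem thirdTerm_eq_bot_iff_nilpotencyClass_le :
    thirdTerm G = ⊥ ↔ Group.nilpotencyClass G ≤ 2 :=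
  Subgroup.lowerCentralSeries_eq_bot_iff_nilpotencyClass_le (G := G) (n := 2)

theorem thirdTerm_le_center_iff_nilpotencyClass_le :
    thirdTerm G ≤ Subgroup.center G ↔ Group.nilpotencyClass G ≤ 3 := by
  rw [← Subgroup.lowerCentralSeries_eq_bot_iff_nilpotencyClass_le,
    ← Subgroup.commutator_top_right_eq_bot_iff_le_center]
  rfl

end ClassThree

theorem corollary3p10 (p : ℕ) (hp : p.Prime) (G : Type*) [Group G] [Finite G]
    (hpG : IsPGroup p G) (hcam : IsCaminaGroup G)
    (hcls : Group.nilpotencyClass G = 3)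
    (hcard : (Nat.card (thirdTerm G) : ℝ) >
      Real.sqrt ((thirdTerm G).relIndex (commutator G) : ℝ)) :
    Subgroup.centralizer (commutator G : Set G) = commutator G := by
  have : Fact p.Prime := ⟨hp⟩
  have : Group.IsNilpotent G := hpG.isNilpotent
  have hU : thirdTerm G ≤ Subgroup.center G :=
    thirdTerm_le_center_iff_nilpotencyClass_le.2 hcls.le
  have hne : thirdTerm G ≠ ⊥ := by
    rw [Ne, thirdTerm_eq_bot_iff_nilpotencyClass_le, hcls]
    decide
  refine le_antisymm (fun a ha => ?_) (commutator_le_centralizer_commutator hU)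
  by_contra haD
  have hsq : Nat.card (thirdTerm G) ^ 2 ≤ (thirdTerm G).relIndex (commutator G) := calc
    _ ≤ (commutator G).relIndex (Subgroup.centralizer (commutator G : Set G)) :=
      hcam.card_thirdTerm_sq_le hpG hU hne ha haD
    _ ≤ (Subgroup.centralizer (commutator G : Set G)).index :=
      hcam.relIndex_centralizer_le_index hU hne
    _ ≤ (thirdTerm G).relIndex (commutator G) := hcam.index_centralizer_le hU ha haD
  exact hcard.not_ge (Real.le_sqrt_of_sq_le (by exact_mod_cast hsq))
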